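/- Setting. Let $d,h,m$ be natural numbers, $\mathcal V=\{1,\dots,m\}^d\subset\mathbb Z^d$ and $\mathbb N_h=\{-h,\dots,h\}^d\setminus\{0\}$. Let $\phi=(\phi_v)_{v\in\mathbb N_h}$ be a real vector that is the parameter of a stationary Gaussian Markov random field on $\mathbb Z^d$ with unit variance and neighbourhood $\mathbb N_h$. That is, there is a positive, boundedly invertible operator $\Gamma=\Gamma(\phi)=(\Gamma_{i,j})_{i,j\in\mathbb Z^d}$ on $\ell^2(\mathbb Z^d)$ with $\Gamma_{i+v,j+v}=\Gamma_{i,j}$ and $\Gamma_{i,i}=1$ for all $i,j,v\in\mathbb Z^d$ such that $\Gamma^{-1}_{i,j}/\Gamma^{-1}_{i,i}$ equals $-\phi_{i-j}$ if $i-j\in\mathbb N_h$, $1$ if $i=j$, and $0$ otherwise. Write $\|\phi\|_1=\sum_v|\phi_v|$ and $\|\phi\|_2^2=\sum_v\phi_v^2$. Let $\mathbb P_0$ be the law on $\mathbb R^{\mathcal V}$ under which the coordinates are independent standard normal. For $S\subset\mathcal V$ let $\mathbb P_{S,\phi}$ be the law under which $(X_i)_{i\in S}$ is centred Gaussian with covariance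 matrix $(\Gamma_{i,j}(\phi))_{i,j\in S}$ and is independent of $(X_i)_{i\notin S}$, whose coordinates are independent standard normal. A test is a measurable function $f:\mathbb R^{\mathcal V}\to\{0,1\}$. For a finite nonempty class $\mathcal C$ of subsets of $\mathcal V$ and a probability distribution $\nu$ on $\mathcal C$, the Bayes risk and the minimax risk are $$\bar R^*_{\nu,\phi}=\inf_f\Big[\mathbb P_0\{f=1\}+\sum_{S\in\mathcal C}\nu(S)\,\mathbb P_{S,\phi}\{f=0\}\Big],\qquad R^*_{\mathcal C,\phi}=\inf_f\Big[\mathbb P_0\{f=1\}+\max_{S\in\mathcal C}\mathbb P_{S,\phi}\{f=0\}\Big].$$ (1) Let $\mathcal C$ be a nonempty class of pairwise disjoint subsets of $\mathcal V$, let $\nu$ be the uniform distribution on $\mathcal C$, and let $\phi$ be as above with $\|\phi\|_1<1/2$. Then $$\bar R^*_{\nu,\phi}\ \ge\ 1-\frac1{2|\mathcal C|}\left[\sum_{S\in\mathcal C}\exp\left(\frac{10\,|S|\,\|\phi\|_2^2}{1-2\|\phi\|_1}\right)\right]^{1/2}.$$ (2) Consequently, for every sequence of such problems (where $d,h,m,\mathcal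 C,\phi$ may all vary along the sequence, each $\mathcal C$ being a nonempty class of pairwise disjoint sets and each $\phi$ satisfying $\|\phi\|_1<1/2$) along which $$\log|\mathcal C|-\frac{10\,\|\phi\|_2^2}{1-2\|\phi\|_1}\max_{S\in\mathcal C}|S|\ \to\ \infty,$$ the hypotheses merge asymptotically: $R^*_{\mathcal C,\phi}\to1$. -/

import Mathlib

open MeasureTheory ProbabilityTheory Filter Topology

noncomputable section

namespace GMRF

/-- The box `{1, …, m}^d` in `ℤ^d`, as a type; it indexes the observed variables. -/
abbrev Box (d m : ℕ) : Type :=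
  ↥(Finset.Icc (fun _ : Fin d => (1 : ℤ)) (fun _ : Fin d => (m : ℤ)))

/-- The neighbourhood `ℕ_h = {-h, …, h}^d \ {0}`. -/
def nbhd (d h : ℕ) : Finset (Fin d → ℤ) :=
  (Finset.Icc (fun _ : Fin d => -(h : ℤ)) (fun _ : Fin d => (h : ℤ))).erase 0

/-- `‖φ‖₁`. -/
def normOne {d h : ℕ} (φ : nbhd d h → ℝ) : ℝ := ∑ v, |φ v|

/-- `‖φ‖₂²`. -/
def normTwoSq {d h : ℕ} (φ : nbhd d h → ℝ) : ℝ := ∑ v, φ v ^ 2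

/-- The real Hilbert space `ℓ²(ℤ^d)`. -/
abbrev EllTwo (d : ℕ) : Type := lp (fun _ : Fin d → ℤ => ℝ) 2

/-- The matrix entry `T_{i,j} = ⟨e_i, T e_j⟩` of a bounded operator on `ℓ²(ℤ^d)`. -/
def entry {d : ℕ} (T : EllTwo d →L[ℝ] EllTwo d) (i j : Fin d → ℤ) : ℝ :=
  T (lp.single 2 j (1 : ℝ)) i

/-- `Γ` is a nonsingular covariance operator of a stationary Gaussian Markov random field on `ℤ^d`
with unit variance and neighbourhood `ℕ_h`, and `φ` is its parameter vector: the entries of the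
inverse operator satisfy `Γ⁻¹_{i,j} / Γ⁻¹_{i,i} = -φ_{i-j}` if `i - j ∈ ℕ_h`, `1` if `i = j`,
and `0` otherwise. In other words `φ ∈ Φ_h` and `Γ = Γ(φ)`. -/
structure IsGMRFCovariance {d h : ℕ} (φ : nbhd d h → ℝ) (Γ : EllTwo d →L[ℝ] EllTwo d) :
    Prop where
  isPositive : Γ.IsPositive
  isUnit : IsUnit Γ
  stationary : ∀ i j v : Fin d → ℤ, entry Γ (i + v) (j + v) = entry Γ i j
  unit_variance : ∀ i : Fin d → ℤ, entry Γ i i = 1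
  inverse_entries : ∀ i j : Fin d → ℤ,
    entry (Ring.inverse Γ) i j / entry (Ring.inverse Γ) i i =
      if hv : i - j ∈ nbhd d h then -φ ⟨i - j, hv⟩ else if i = j then 1 else 0

/-- The principal submatrix `Γ_S`. -/
def subCov {d m : ℕ} (Γ : EllTwo d →L[ℝ] EllTwo d) (S : Finset (Box d m)) : Matrix S S ℝ :=
  Matrix.of fun i j => entry Γ (i : Box d m) (j : Box d m)

/-- The null distribution `ℙ₀`: all variables are independent standard normal. -/
def nullLaw (d m : ℕ) : Measure (Box d m → ℝ) := Measure.pi fun _ => gaussianReal 0 1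

/-- The distribution `ℙ_{S,Γ}` of `X` when `S` is anomalous: `X_i = Y_i` for `i ∈ S` and
`X_i = Z_i` for `i ∉ S`, where `(Y_i)_{i ∈ S}` is centred Gaussian with covariance matrix `Γ_S`,
the `Z_i` are independent standard normal, and `Y` and `Z` are independent. -/
def altLaw {d m : ℕ} (Γ : EllTwo d →L[ℝ] EllTwo d) (S : Finset (Box d m)) :
    Measure (Box d m → ℝ) :=
  ((multivariateGaussian (0 : EuclideanSpace ℝ S) (subCov Γ S)).prod (nullLaw d m)).map
    fun p i => if hi : i ∈ S then p.1 ⟨i, hi⟩ else p.2 i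

/-- Tests: measurable functions `ℝ^𝒱 → {0, 1}`. -/
abbrev Test (d m : ℕ) : Type := {f : (Box d m → ℝ) → Fin 2 // Measurable f}

/-- Probability of type I error. -/
def typeOne {d m : ℕ} (f : Test d m) : ℝ := (nullLaw d m).real {x | f.1 x = 1}

/-- Probability of type II error when `S` is the anomalous set. -/
def typeTwo {d m : ℕ} (Γ : EllTwo d →L[ℝ] EllTwo d) (S : Finset (Box d m)) (f : Test d m) : ℝ :=
  (altLaw Γ S).real {x | f.1 x = 0}

/-- The Bayes risk for the prior `ν` on the class `C`: infimum over all tests of the average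
risk `ℙ₀{f = 1} + ∑_{S ∈ C} ν(S) ℙ_{S,Γ}{f = 0}`. -/
def bayesRisk {d m : ℕ} (C : Finset (Finset (Box d m))) (ν : PMF (Finset (Box d m)))
    (Γ : EllTwo d →L[ℝ] EllTwo d) : ℝ :=
  ⨅ f : Test d m, (typeOne f + ∑ S ∈ C, (ν S).toReal * typeTwo Γ S f)

/-- The minimax risk: infimum over all tests of `ℙ₀{f = 1} + max_{S ∈ C} ℙ_{S,Γ}{f = 0}`. -/
def minimaxRisk {d m : ℕ} (C : Finset (Finset (Box d m))) (Γ : EllTwo d →L[ℝ] EllTwo d) : ℝ :=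
  ⨅ f : Test d m, (typeOne f + ⨆ S : C, typeTwo Γ (S : Finset (Box d m)) f)

end GMRF

end

/-!
The Bayes risk is bounded through the second moment of the likelihood ratio. For a uniform prior
on `N` disjoint sets the likelihood ratios `L_S` of the alternatives against `ℙ₀` are pairwise
independent under `ℙ₀`, because `L_S` depends on the coordinates in `S` only. Hence the variance
of their sum is at most `∑ 𝔼₀ L_S²`. The risk of a test with rejection region `A` equals
`1 - cov(1_A, ∑ L_S) / N`, and the Cauchy–Schwarz inequality together with `Var 1_A ≤ 1 / 4` gives
`1 - (∑ 𝔼₀ L_S²)^{1/2} / (2 N)` as a lower bound (`one_sub_le_risk_of_pairwise_indepFun`).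

In an orthonormal eigenbasis of `Γ_S` both the standard Gaussian and `N(0, Γ_S)` are product
measures, so `𝔼₀ L_S²` is the product of the one-dimensional second moments
`(λ (2 - λ))^{-1/2} = (1 - (λ - 1)²)^{-1/2}` over the eigenvalues `λ` of `Γ_S`
(`multivariateGaussian_eq_withDensity`, `lintegral_gaussianLikelihood_sq`). It remains to keep `λ`
away from `0` and `2`, and to bound `∑ (λ - 1)²`, which is the squared Frobenius norm of `Γ_S - 1`.

Both come from the identity `Γ⁻¹ = c (1 - Φ)`, where `Φ` is the Toeplitz operator of `φ`
(`IsGMRFCovariance.inverse_eq`). Its norm is at most `‖φ‖₁ < 1 / 2`, and unit variance forces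
`1 ≤ c ≤ 1 / (1 - ‖φ‖₁)`. Consequently `1 / 3 ≤ λ ≤ 1 / (1 - ‖φ‖₁)`, whence
`λ (2 - λ) ≥ (1 - 2 ‖φ‖₁) / 3`. Since `Γ e_j = c⁻¹ e_j + Γ Φ e_j`, the off-diagonal part of each
column of `Γ` has squared norm at most `4 ‖φ‖₂²` (`IsGMRFCovariance.sum_entry_sq_le`). Altogether
`𝔼₀ L_S² ≤ exp (6 |S| ‖φ‖₂² / (1 - 2 ‖φ‖₁))`, which is stronger than what is needed.

For the minimax risk, the maximum over the class dominates the average, and the test that always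
rejects has risk one.
-/

noncomputable section

namespace GMRF

open scoped RealInnerProductSpace ENNReal NNReal

/-! ### Operators whose inverse is a multiple of a perturbation of the identity -/

section Hilbert

variable {E : Type*} [NormedAddCommGroup E] [InnerProductSpace ℝ E]
  {Γ B Φ : E →L[ℝ] E} {a c : ℝ}

theorem inner_le_of_norm_le (hΦ : ‖Φ‖ ≤ a) (y : E) :
    |⟪Φ y, y⟫| ≤ a * ‖y‖ ^ 2 := by
  calc |⟪Φ y, y⟫| ≤ ‖Φ y‖ * ‖y‖ := abs_real_inner_le_norm _ _
    _ ≤ (a * ‖y‖) * ‖y‖ := by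
      gcongr
      exact (Φ.le_opNorm y).trans (by gcongr)
    _ = a * ‖y‖ ^ 2 := by ring

/-- The scale of the precision operator is at least one: this is Cauchy–Schwarz for the form
`⟪Γ ·, ·⟫` applied to `e` and `Γ⁻¹ e`. -/
theorem one_le_inner_inverse (hpos : Γ.IsPositive) (hΓB : ∀ x, Γ (B x) = x) {e : E}
    (he : ‖e‖ = 1) (hΓe : ⟪Γ e, e⟫ = 1) : 1 ≤ ⟪B e, e⟫ := by
  have h := hpos.inner_nonneg_left (B e - e)
  have hs : ⟪Γ e, B e⟫ = 1 := by
    rw [show ⟪Γ e, B e⟫ = ⟪e, Γ (B e)⟫ from hpos.isSymmetric e (B e), hΓB, real_inner_self_eq_norm_sq,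
      he]
    norm_num
  rw [map_sub, hΓB, inner_sub_left, inner_sub_right, inner_sub_right, hs, hΓe,
    real_inner_self_eq_norm_sq, he, real_inner_comm] at h
  linarith

/-- If `Γ⁻¹ = c (1 - Φ)` with `‖Φ‖ ≤ a`, then `Γ⁻¹` expands norms at least by `c (1 - a)`. -/
theorem norm_le_of_inverse_eq (hc : 1 ≤ c) (hΦ : ‖Φ‖ ≤ a)
    (hBΓ : ∀ x, B (Γ x) = x) (hB : ∀ x, B x = c • (x - Φ x)) (x : E) :
    c * (1 - a) * ‖Γ x‖ ≤ ‖x‖ := by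
  have h1 : ‖x‖ = c * ‖Γ x - Φ (Γ x)‖ := by
    conv_lhs => rw [← hBΓ x, hB, norm_smul, Real.norm_of_nonneg (by linarith)]
  have h2 : ‖Γ x‖ - ‖Φ (Γ x)‖ ≤ ‖Γ x - Φ (Γ x)‖ := norm_sub_norm_le _ _
  have h3 : ‖Φ (Γ x)‖ ≤ a * ‖Γ x‖ := (Φ.le_opNorm _).trans (by gcongr)
  rw [h1, mul_assoc]
  gcongr
  linarith

theorem inner_le_of_inverse_eq (ha : a < 1) (hc : 1 ≤ c) (hΦ : ‖Φ‖ ≤ a)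
    (hBΓ : ∀ x, B (Γ x) = x) (hB : ∀ x, B x = c • (x - Φ x)) (x : E) :
    (1 - a) * ⟪Γ x, x⟫ ≤ ‖x‖ ^ 2 := by
  have h := norm_le_of_inverse_eq hc hΦ hBΓ hB x
  have h0 : (1 - a) * ‖Γ x‖ ≤ c * (1 - a) * ‖Γ x‖ := by
    have : 0 ≤ (1 - a) * ‖Γ x‖ := mul_nonneg (by linarith) (norm_nonneg _)
    nlinarith
  calc (1 - a) * ⟪Γ x, x⟫ ≤ (1 - a) * (‖Γ x‖ * ‖x‖) := by
        exact mul_le_mul_of_nonneg_left (real_inner_le_norm _ _) (by linarith)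
    _ = ((1 - a) * ‖Γ x‖) * ‖x‖ := by ring
    _ ≤ ‖x‖ * ‖x‖ := mul_le_mul_of_nonneg_right (h0.trans h) (norm_nonneg _)
    _ = ‖x‖ ^ 2 := by ring

/-- A uniform lower bound for the covariance form. Unit variance bounds the scale `c` by
`1 / (1 - a) ≤ 2`, and then `⟪Γ⁻¹ x, x⟫ ≤ c (1 + a) ‖x‖² ≤ 3 ‖x‖²`; the bound for `Γ` itself
follows by Cauchy–Schwarz for the form `⟪Γ ·, ·⟫`. -/
theorem third_le_inner_of_inverse_eq (hpos : Γ.IsPositive) (ha : a < 1 / 2) (hc : 1 ≤ c)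
    (hΦ : ‖Φ‖ ≤ a) (hΓB : ∀ x, Γ (B x) = x) (hBΓ : ∀ x, B (Γ x) = x)
    (hB : ∀ x, B x = c • (x - Φ x)) {e : E} (he : ‖e‖ = 1) (hΓe : ⟪Γ e, e⟫ = 1) (x : E) :
    ‖x‖ ^ 2 / 3 ≤ ⟪Γ x, x⟫ := by
  have ha0 : 0 ≤ a := (norm_nonneg _).trans hΦ
  have hca : c * (1 - a) ≤ 1 := by
    have h1 := norm_le_of_inverse_eq hc hΦ hBΓ hB e
    have h2 : (1 : ℝ) ≤ ‖Γ e‖ := by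
      have := real_inner_le_norm (Γ e) e
      rw [hΓe, he] at this
      linarith
    rw [he] at h1
    have : 0 ≤ c * (1 - a) := mul_nonneg (by linarith) (by linarith)
    nlinarith
  have hBx : ⟪B x, x⟫ ≤ 3 * ‖x‖ ^ 2 := by
    have h1 := (abs_le.1 (inner_le_of_norm_le hΦ x)).1
    rw [hB, real_inner_smul_left, inner_sub_left, real_inner_self_eq_norm_sq]
    have h2 : c * (1 + a) ≤ 3 := by nlinarith
    calc c * (‖x‖ ^ 2 - ⟪Φ x, x⟫) ≤ c * (‖x‖ ^ 2 + a * ‖x‖ ^ 2) := by gcongr; linarith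
      _ = c * (1 + a) * ‖x‖ ^ 2 := by ring
      _ ≤ 3 * ‖x‖ ^ 2 := by gcongr
  -- Among the vectors `x - s Γ⁻¹ x`, the value `s = 1 / 3` is optimal for the bound `hBx`.
  have h := hpos.inner_nonneg_left (x - (1 / 3 : ℝ) • B x)
  have hs : ⟪Γ x, B x⟫ = ‖x‖ ^ 2 := by
    rw [show ⟪Γ x, B x⟫ = ⟪x, Γ (B x)⟫ from hpos.isSymmetric x (B x), hΓB,
      real_inner_self_eq_norm_sq]
  rw [map_sub, map_smul, hΓB, inner_sub_left, inner_sub_right, inner_sub_right,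
    real_inner_smul_left, real_inner_smul_left, real_inner_smul_right, real_inner_smul_right, hs,
    real_inner_self_eq_norm_sq, real_inner_comm (B x) x] at h
  linarith

theorem apply_eq_of_inverse_eq (hc : 1 ≤ c) (hΓB : ∀ x, Γ (B x) = x)
    (hB : ∀ x, B x = c • (x - Φ x)) (e : E) : Γ e = c⁻¹ • e + Γ (Φ e) := by
  have h := hΓB e
  rw [hB, map_smul, map_sub] at h
  rw [← sub_eq_iff_eq_add]
  conv_rhs => rw [← h]
  rw [smul_smul, inv_mul_cancel₀ (by linarith), one_smul]

end Hilbert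

/-! ### Shifts of `ℓ²(ℤ^d)` -/

variable {d h : ℕ}

theorem ellTwo_norm_sq (f : EllTwo d) : ‖f‖ ^ 2 = ∑' i, f i ^ 2 := by
  have := lp.norm_rpow_eq_tsum (p := 2) (by norm_num) f
  simpa using this

theorem ellTwo_summable_sq (f : EllTwo d) : Summable fun i => f i ^ 2 := by
  have := (lp.memℓp f).summable (by norm_num)
  simpa using this

theorem sum_sq_le_norm_sq (f : EllTwo d) (s : Finset (Fin d → ℤ)) :
    ∑ i ∈ s, f i ^ 2 ≤ ‖f‖ ^ 2 := by
  rw [ellTwo_norm_sq]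
  exact (ellTwo_summable_sq f).sum_le_tsum _ fun _ _ => sq_nonneg _

/-- The translation `(shift v f)_i = f_{i - v}`, an isometry of `ℓ²(ℤ^d)`. -/
def shift (v : Fin d → ℤ) : EllTwo d →ₗᵢ[ℝ] EllTwo d where
  toFun f := ⟨fun i => f (i - v), memℓp_gen (by
    have := (Equiv.subRight v).summable_iff.2 (ellTwo_summable_sq f)
    simpa [Function.comp_def] using this)⟩
  map_add' f g := rfl
  map_smul' c f := rfl
  norm_map' f := by
    rw [← sq_eq_sq₀ (norm_nonneg _) (norm_nonneg _), ellTwo_norm_sq, ellTwo_norm_sq]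
    exact (Equiv.subRight v).tsum_eq fun i => f i ^ 2

theorem shift_apply (v : Fin d → ℤ) (f : EllTwo d) (i : Fin d → ℤ) : shift v f i = f (i - v) := rfl

theorem shift_single (v j : Fin d → ℤ) :
    shift v (lp.single 2 j (1 : ℝ)) = lp.single 2 (j + v) (1 : ℝ) := by
  ext i
  rw [shift_apply, lp.coeFn_single, lp.coeFn_single, Pi.single_apply, Pi.single_apply]
  simp only [sub_eq_iff_eq_add]

/-- A bounded operator on `ℓ²(ℤ^d)` is determined by its matrix entries, since finitely supported
sequences are dense. -/
theorem clm_ext_entry {T T' : EllTwo d →L[ℝ] EllTwo d} (hT : ∀ i j, entry T i j = entry T' i j) :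
    T = T' := by
  have hs : ∀ j, T (lp.single 2 j (1 : ℝ)) = T' (lp.single 2 j (1 : ℝ)) := fun j => by
    ext i; exact hT i j
  ext1 f
  have hf := lp.hasSum_single (p := 2) (by norm_num) f
  have hs' : ∀ i, T (lp.single 2 i (f i)) = T' (lp.single 2 i (f i)) := fun i => by
    have : lp.single (E := fun _ : Fin d → ℤ => ℝ) 2 i (f i) = f i • lp.single 2 i (1 : ℝ) := by
      rw [← lp.single_smul, smul_eq_mul, mul_one]
    rw [this, map_smul, map_smul, hs]
  have h1 := hf.mapL T
  have h2 := hf.mapL T'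
  simp only [hs'] at h1
  exact h1.unique h2

theorem inner_single (j : Fin d → ℤ) (f : EllTwo d) : ⟪f, lp.single 2 j (1 : ℝ)⟫ = f j := by
  simpa using lp.inner_single_right (𝕜 := ℝ) (G := fun _ : Fin d → ℤ => ℝ) j (1 : ℝ) f

theorem entry_eq_inner (T : EllTwo d →L[ℝ] EllTwo d) (i j : Fin d → ℤ) :
    entry T i j = ⟪T (lp.single 2 j (1 : ℝ)), lp.single 2 i (1 : ℝ)⟫ := by
  rw [inner_single]; rfl

/-- The Toeplitz operator with symbol `φ`: its entries are `φ_{i - j}` for `i - j ∈ ℕ_h`. -/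
def toeplitz (φ : nbhd d h → ℝ) : EllTwo d →L[ℝ] EllTwo d :=
  ∑ v, φ v • (shift (v : Fin d → ℤ)).toContinuousLinearMap

theorem toeplitz_apply (φ : nbhd d h → ℝ) (f : EllTwo d) :
    toeplitz φ f = ∑ v, φ v • shift (v : Fin d → ℤ) f := by
  simp [toeplitz]

theorem norm_toeplitz_le (φ : nbhd d h → ℝ) : ‖toeplitz φ‖ ≤ normOne φ := by
  refine (norm_sum_le _ _).trans (Finset.sum_le_sum fun v _ => ?_)
  rw [norm_smul, Real.norm_eq_abs]
  exact mul_le_of_le_one_right (abs_nonneg _) (LinearIsometry.norm_toContinuousLinearMap_le _)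

theorem entry_toeplitz (φ : nbhd d h → ℝ) (i j : Fin d → ℤ) :
    entry (toeplitz φ) i j = if hv : i - j ∈ nbhd d h then φ ⟨i - j, hv⟩ else 0 := by
  have : entry (toeplitz φ) i j = ∑ v : nbhd d h, if i - j = (v : Fin d → ℤ) then φ v else 0 := by
    rw [entry, toeplitz_apply, lp.coeFn_sum, Finset.sum_apply]
    refine Finset.sum_congr rfl fun v _ => ?_
    rw [lp.coeFn_smul, Pi.smul_apply, shift_single, lp.coeFn_single, Pi.single_apply]
    simp [sub_eq_iff_eq_add, add_comm]
  rw [this]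
  split_ifs with hv
  · rw [Finset.sum_eq_single ⟨i - j, hv⟩]
    · simp
    · rintro b - hb
      rw [if_neg]
      rintro hb'
      exact hb (Subtype.ext hb'.symm)
    · simp
  · refine Finset.sum_eq_zero fun v _ => if_neg ?_
    rintro hv'
    exact hv (hv' ▸ v.2)

theorem norm_toeplitz_single_sq (φ : nbhd d h → ℝ) (j : Fin d → ℤ) :
    ‖toeplitz φ (lp.single 2 j (1 : ℝ))‖ ^ 2 = normTwoSq φ := by
  rw [← real_inner_self_eq_norm_sq, toeplitz_apply, sum_inner]
  refine Finset.sum_congr rfl fun v _ => ?_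
  rw [inner_sum, Finset.sum_eq_single v]
  · rw [real_inner_smul_left, real_inner_smul_right, real_inner_self_eq_norm_sq,
      LinearIsometry.norm_map, lp.norm_single (by norm_num)]
    norm_num
    ring
  · rintro w - hw
    rw [real_inner_smul_left, real_inner_smul_right, shift_single, shift_single, inner_single,
      lp.coeFn_single, Pi.single_apply, if_neg]
    · simp
    · intro h'
      exact hw (Subtype.ext (add_left_cancel h'))
  · simp

/-! ### The covariance operator of a Gaussian Markov random field -/

theorem norm_single_one (j : Fin d → ℤ) :
    ‖lp.single (E := fun _ : Fin d → ℤ => ℝ) 2 j (1 : ℝ)‖ = 1 := by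
  rw [lp.norm_single (by norm_num)]; simp

namespace IsGMRFCovariance

variable {φ : nbhd d h → ℝ} {Γ : EllTwo d →L[ℝ] EllTwo d}

theorem apply_inverse (hΓ : IsGMRFCovariance φ Γ) (x : EllTwo d) : Γ (Ring.inverse Γ x) = x := by
  have := congrArg (fun T : EllTwo d →L[ℝ] EllTwo d => T x) (Ring.mul_inverse_cancel Γ hΓ.isUnit)
  simpa using this

theorem inverse_apply (hΓ : IsGMRFCovariance φ Γ) (x : EllTwo d) : Ring.inverse Γ (Γ x) = x := by
  have := congrArg (fun T : EllTwo d →L[ℝ] EllTwo d => T x) (Ring.inverse_mul_cancel Γ hΓ.isUnit)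
  simpa using this

/-- Stationarity passes to the diagonal of the inverse, because `Γ` commutes with shifts. -/
theorem entry_inverse_self (hΓ : IsGMRFCovariance φ Γ) (i : Fin d → ℤ) :
    entry (Ring.inverse Γ) i i = entry (Ring.inverse Γ) 0 0 := by
  have hcomm : Γ * (shift i).toContinuousLinearMap = (shift i).toContinuousLinearMap * Γ := by
    refine clm_ext_entry fun k l => ?_
    have h1 := hΓ.stationary (k - i) l i
    rw [sub_add_cancel] at h1
    change Γ (shift i (lp.single 2 l (1 : ℝ))) k = entry Γ (k - i) l
    rw [shift_single, ← h1]
    rfl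
  have hx : ∀ x, Ring.inverse Γ (shift i x) = shift i (Ring.inverse Γ x) := fun x => by
    have := congrArg (fun T : EllTwo d →L[ℝ] EllTwo d => T (Ring.inverse Γ x)) hcomm
    have : Γ (shift i (Ring.inverse Γ x)) = shift i (Γ (Ring.inverse Γ x)) := by simpa using this
    rw [hΓ.apply_inverse] at this
    rw [← this, hΓ.inverse_apply]
  have h0 := hx (lp.single 2 0 1)
  rw [shift_single, zero_add] at h0
  rw [entry, h0, shift_apply, sub_self]
  rfl

/-- The precision operator is `c (1 - Φ)` with `c = Γ⁻¹_{0,0}` and `Φ` the Toeplitz operator of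
`φ`. -/
theorem inverse_eq (hΓ : IsGMRFCovariance φ Γ) (x : EllTwo d) :
    Ring.inverse Γ x = entry (Ring.inverse Γ) 0 0 • (x - toeplitz φ x) := by
  set c := entry (Ring.inverse Γ) 0 0 with hc
  -- If `c` vanished, the diagonal ratio would be `0 / 0 = 0` instead of `1`.
  have hc0 : c ≠ 0 := by
    intro h0
    have := hΓ.inverse_entries 0 0
    rw [← hc, h0] at this
    simp [nbhd] at this
  suffices Ring.inverse Γ = c • (1 - toeplitz φ) by
    conv_lhs => rw [this]
    rfl
  refine clm_ext_entry fun i j => ?_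
  have h1 := hΓ.inverse_entries i j
  rw [hΓ.entry_inverse_self, div_eq_iff hc0] at h1
  have h2 : entry (c • (1 - toeplitz φ)) i j =
      c * ((if i = j then 1 else 0) - entry (toeplitz φ) i j) := by
    change c * ((lp.single (E := fun _ : Fin d → ℤ => ℝ) 2 j (1 : ℝ)) i - _) = _
    rw [lp.coeFn_single, Pi.single_apply]
    rfl
  rw [h1, h2, entry_toeplitz]
  by_cases hv : i - j ∈ nbhd d h
  · have hij : i ≠ j := by
      rintro rfl
      simp [nbhd] at hv
    simp [hv, hij, mul_comm, hc]
  · simp [hv, mul_comm, hc]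

theorem inner_apply_single (hΓ : IsGMRFCovariance φ Γ) (j : Fin d → ℤ) :
    ⟪Γ (lp.single 2 j (1 : ℝ)), lp.single 2 j (1 : ℝ)⟫ = 1 := by
  rw [← entry_eq_inner, hΓ.unit_variance]

theorem one_le_entry_inverse (hΓ : IsGMRFCovariance φ Γ) : 1 ≤ entry (Ring.inverse Γ) 0 0 := by
  rw [entry_eq_inner]
  exact one_le_inner_inverse hΓ.isPositive hΓ.apply_inverse (norm_single_one 0)
    (hΓ.inner_apply_single 0)

theorem third_le_inner (hΓ : IsGMRFCovariance φ Γ) (hφ : normOne φ < 1 / 2) (x : EllTwo d) :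
    ‖x‖ ^ 2 / 3 ≤ ⟪Γ x, x⟫ :=
  third_le_inner_of_inverse_eq hΓ.isPositive hφ hΓ.one_le_entry_inverse (norm_toeplitz_le φ)
    hΓ.apply_inverse hΓ.inverse_apply hΓ.inverse_eq (norm_single_one 0)
    (hΓ.inner_apply_single 0) x

theorem inner_le (hΓ : IsGMRFCovariance φ Γ) (hφ : normOne φ < 1 / 2) (x : EllTwo d) :
    (1 - normOne φ) * ⟪Γ x, x⟫ ≤ ‖x‖ ^ 2 :=
  inner_le_of_inverse_eq (by linarith) hΓ.one_le_entry_inverse (norm_toeplitz_le φ)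
    hΓ.inverse_apply hΓ.inverse_eq x

/-- Off the diagonal, the column `Γ e_j` coincides with `Γ Φ e_j`, whose norm is at most
`2 ‖φ‖₂`. -/
theorem sum_entry_sq_le (hΓ : IsGMRFCovariance φ Γ) (hφ : normOne φ < 1 / 2) (j : Fin d → ℤ)
    (s : Finset (Fin d → ℤ)) (hj : j ∉ s) : ∑ i ∈ s, entry Γ i j ^ 2 ≤ 4 * normTwoSq φ := by
  have hc := hΓ.one_le_entry_inverse
  set u := toeplitz φ (lp.single 2 j (1 : ℝ)) with hu
  have h1 : ∀ i ∈ s, entry Γ i j = Γ u i := fun i hi => by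
    have hij : i ≠ j := fun h' => hj (h' ▸ hi)
    rw [entry, apply_eq_of_inverse_eq hc hΓ.apply_inverse hΓ.inverse_eq, lp.coeFn_add,
      Pi.add_apply, lp.coeFn_smul, Pi.smul_apply, lp.coeFn_single, Pi.single_apply, if_neg hij,
      smul_zero, zero_add]
  rw [Finset.sum_congr rfl fun i hi => by rw [h1 i hi]]
  refine (sum_sq_le_norm_sq (Γ u) s).trans ?_
  have h2 := norm_le_of_inverse_eq hc (norm_toeplitz_le φ) hΓ.inverse_apply
    hΓ.inverse_eq u
  have h3 : ‖Γ u‖ ≤ 2 * ‖u‖ := by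
    have : 1 / 2 ≤ entry (Ring.inverse Γ) 0 0 * (1 - normOne φ) := by nlinarith
    nlinarith [norm_nonneg (Γ u)]
  rw [← norm_toeplitz_single_sq φ j, ← hu]
  nlinarith [norm_nonneg (Γ u)]

end IsGMRFCovariance

/-! ### Product measures and densities -/

section Product

variable {ι : Type*} [Fintype ι]

theorem lintegral_pi_prod (μ : ι → Measure ℝ) [∀ i, IsProbabilityMeasure (μ i)]
    {f : ι → ℝ → ℝ≥0∞} (hf : ∀ i, Measurable (f i)) :
    ∫⁻ x, ∏ i, f i (x i) ∂Measure.pi μ = ∏ i, ∫⁻ y, f i y ∂μ i := by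
  have hind : iIndepFun (fun i (x : ι → ℝ) => f i (x i)) (Measure.pi μ) :=
    iIndepFun_pi fun i => (hf i).aemeasurable
  have h := lintegral_prod_eq_prod_lintegral_of_indepFun Finset.univ
    (fun i (x : ι → ℝ) => f i (x i)) hind fun i => (hf i).comp (measurable_pi_apply i)
  rw [h]
  refine Finset.prod_congr rfl fun i _ => ?_
  exact (measurePreserving_eval μ i).lintegral_comp (hf i)

theorem pi_withDensity (μ : ι → Measure ℝ) [∀ i, IsProbabilityMeasure (μ i)]
    {f : ι → ℝ → ℝ≥0∞} (hf : ∀ i, Measurable (f i))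
    [∀ i, SigmaFinite ((μ i).withDensity (f i))] :
    Measure.pi (fun i => (μ i).withDensity (f i)) =
      (Measure.pi μ).withDensity fun x => ∏ i, f i (x i) := by
  refine Measure.pi_eq fun s hs => ?_
  rw [withDensity_apply _ (MeasurableSet.univ_pi hs),
    ← lintegral_indicator (MeasurableSet.univ_pi hs)]
  have h : ∀ x : ι → ℝ, (Set.univ.pi s).indicator (fun x => ∏ i, f i (x i)) x =
      ∏ i, (s i).indicator (f i) (x i) := fun x => by
    by_cases hx : x ∈ Set.univ.pi s
    · rw [Set.indicator_of_mem hx]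
      exact Finset.prod_congr rfl fun i _ => (Set.indicator_of_mem (hx i trivial) _).symm
    · rw [Set.indicator_of_notMem hx]
      simp only [Set.mem_pi, Set.mem_univ, true_implies, not_forall] at hx
      obtain ⟨i, hi⟩ := hx
      exact (Finset.prod_eq_zero (Finset.mem_univ i) (Set.indicator_of_notMem hi _)).symm
  simp_rw [h]
  rw [lintegral_pi_prod μ fun i => (hf i).indicator (hs i)]
  refine Finset.prod_congr rfl fun i _ => ?_
  rw [withDensity_apply _ (hs i), lintegral_indicator (hs i)]

end Product

theorem map_withDensity_comp {α β : Type*} [MeasurableSpace α] [MeasurableSpace β] {μ : Measure α}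
    {g : α → β} (hg : Measurable g) {f : β → ℝ≥0∞} (hf : Measurable f) :
    (μ.withDensity (f ∘ g)).map g = (μ.map g).withDensity f := by
  ext s hs
  rw [Measure.map_apply hg hs, withDensity_apply _ (hg hs), withDensity_apply _ hs,
    setLIntegral_map hs hf hg]
  rfl

/-! ### The likelihood ratio of two centred Gaussians -/

/-- The density of `N(0, v)` with respect to `N(0, 1)`. -/
def gaussianRatio (v : ℝ≥0) (x : ℝ) : ℝ≥0∞ := gaussianPDF 0 v x / gaussianPDF 0 1 x

theorem measurable_gaussianRatio (v : ℝ≥0) : Measurable (gaussianRatio v) :=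
  (measurable_gaussianPDF 0 v).div (measurable_gaussianPDF 0 1)

theorem withDensity_gaussianRatio {v : ℝ≥0} (hv : v ≠ 0) :
    (gaussianReal 0 1).withDensity (gaussianRatio v) = gaussianReal 0 v := by
  rw [gaussianReal_of_var_ne_zero 0 one_ne_zero, gaussianReal_of_var_ne_zero 0 hv,
    ← withDensity_mul _ (measurable_gaussianPDF 0 1) (measurable_gaussianRatio v)]
  congr 1
  ext x
  exact ENNReal.mul_div_cancel (gaussianPDF_pos 0 one_ne_zero x).ne' gaussianPDF_ne_top

/-- The second moment of the likelihood ratio of `N(0, v)` against `N(0, 1)` is finite for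
`v < 2`: the square of the ratio is, up to a constant, again a Gaussian likelihood ratio, with
variance `v / (2 - v)`. -/
theorem lintegral_gaussianRatio_sq {v : ℝ≥0} (hv : v ≠ 0) (hv2 : v < 2) :
    ∫⁻ x, gaussianRatio v x ^ 2 ∂gaussianReal 0 1 =
      ENNReal.ofReal (√(v * (2 - v)))⁻¹ := by
  have hv0 : (0 : ℝ) < v := by exact_mod_cast hv.bot_lt
  have hv2' : (0 : ℝ) < 2 - v := by
    have : (v : ℝ) < 2 := by exact_mod_cast hv2
    linarith
  set w : ℝ≥0 := v / (2 - v) with hw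
  have hwr : (w : ℝ) = v / (2 - v) := by
    rw [hw, NNReal.coe_div, NNReal.coe_sub hv2.le]; rfl
  have hw0 : (0 : ℝ) < w := by rw [hwr]; positivity
  have key : ∀ x, gaussianPDF 0 1 x * gaussianRatio v x ^ 2 =
      ENNReal.ofReal (√(v * (2 - v)))⁻¹ * gaussianPDF 0 w x := fun x => by
    have h1 := gaussianPDFReal_pos 0 1 x one_ne_zero
    rw [gaussianRatio]
    simp only [gaussianPDF]
    rw [← ENNReal.ofReal_div_of_pos h1, ← ENNReal.ofReal_pow (div_nonneg (gaussianPDFReal_nonneg 0 v x) h1.le),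
      ← ENNReal.ofReal_mul h1.le, ← ENNReal.ofReal_mul (by positivity)]
    congr 1
    have h2 : gaussianPDFReal 0 1 x * (gaussianPDFReal 0 v x / gaussianPDFReal 0 1 x) ^ 2 =
        gaussianPDFReal 0 v x ^ 2 / gaussianPDFReal 0 1 x := by field_simp
    rw [h2, div_eq_iff h1.ne']
    simp only [gaussianPDFReal, sub_zero, NNReal.coe_one, mul_one]
    have e1 : Real.exp (-x ^ 2 / (2 * v)) ^ 2 =
        Real.exp (-x ^ 2 / (2 * w)) * Real.exp (-x ^ 2 / 2) := by
      rw [← Real.exp_nat_mul, ← Real.exp_add, hwr]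
      congr 1
      field_simp
      push_cast
      ring
    have e2 : (√(2 * Real.pi * v))⁻¹ ^ 2 =
        (√(v * (2 - v)))⁻¹ * (√(2 * Real.pi * w))⁻¹ * (√(2 * Real.pi))⁻¹ := by
      rw [← mul_inv, ← mul_inv, inv_pow, Real.sq_sqrt (by positivity),
        ← Real.sqrt_mul (by positivity), ← Real.sqrt_mul (by positivity), hwr]
      congr 1
      symm
      rw [Real.sqrt_eq_iff_mul_self_eq (by positivity) (by positivity)]
      field_simp
    rw [mul_pow, e1, e2]
    ring
  rw [gaussianReal_of_var_ne_zero 0 one_ne_zero,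
    lintegral_withDensity_eq_lintegral_mul _ (measurable_gaussianPDF 0 1)
      ((measurable_gaussianRatio v).pow_const 2)]
  simp only [Pi.mul_apply, key]
  rw [lintegral_const_mul _ (measurable_gaussianPDF 0 w), lintegral_gaussianPDF_eq_one, mul_one]
  exact_mod_cast hw0.ne'

section Multivariate

variable {ι : Type*} [Fintype ι] [DecidableEq ι] {A : Matrix ι ι ℝ}

theorem dotProduct_mulVec_eq_sum_eigenvalues (hA : A.IsHermitian) (t : EuclideanSpace ℝ ι) :
    t.ofLp ⬝ᵥ A.mulVec t.ofLp = ∑ i, hA.eigenvalues i * ⟪hA.eigenvectorBasis i, t⟫ ^ 2 := by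
  have h1 : t.ofLp ⬝ᵥ A.mulVec t.ofLp = ⟪A.toEuclideanLin t, t⟫ := by
    simp [PiLp.inner_apply, dotProduct, Matrix.toLpLin_apply]
  have hsymm := Matrix.isSymmetric_toEuclideanLin_iff.2 hA
  rw [h1, ← hA.eigenvectorBasis.sum_inner_mul_inner]
  refine Finset.sum_congr rfl fun i _ => ?_
  have h2 : A.toEuclideanLin (hA.eigenvectorBasis i) =
      hA.eigenvalues i • hA.eigenvectorBasis i := by
    rw [Matrix.toLpLin_apply, hA.mulVec_eigenvectorBasis]
    rfl
  rw [real_inner_comm, ← hsymm, h2, real_inner_smul_left]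
  ring

/-- In an orthonormal eigenbasis of its covariance matrix, a centred Gaussian vector has
independent coordinates, whose variances are the eigenvalues. -/
theorem multivariateGaussian_eq_map_pi (hA : A.PosSemidef) :
    multivariateGaussian 0 A =
      (Measure.pi fun i => gaussianReal 0 (hA.1.eigenvalues i).toNNReal).map
        fun x => ∑ i, x i • hA.1.eigenvectorBasis i := by
  apply Measure.ext_of_charFun
  ext t
  rw [charFun_multivariateGaussian hA, dotProduct_mulVec_eq_sum_eigenvalues hA.1]
  set b := hA.1.eigenvectorBasis
  have hmeas : Measurable fun x : ι → ℝ => ∑ i, x i • b i := by fun_prop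
  rw [charFun_apply, integral_map hmeas.aemeasurable
    (Measurable.aestronglyMeasurable (by fun_prop))]
  simp_rw [sum_inner, Complex.ofReal_sum, Finset.sum_mul, Complex.exp_sum,
    integral_fintype_prod_eq_prod (f := fun i x => Complex.exp (⟪x • b i, t⟫ * Complex.I)),
    real_inner_smul_left, mul_comm _ (⟪_, _⟫), Complex.ofReal_mul, ← charFun_apply_real,
    charFun_gaussianReal]
  rw [← Complex.exp_sum]
  congr 1
  simp [Finset.sum_div, Real.coe_toNNReal _ (hA.eigenvalues_nonneg _)]

/-- The likelihood ratio of `N(0, A)` against the standard Gaussian distribution. -/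
def gaussianLikelihood (hA : A.PosSemidef) (x : EuclideanSpace ℝ ι) : ℝ≥0∞ :=
  ∏ i, gaussianRatio (hA.1.eigenvalues i).toNNReal (hA.1.eigenvectorBasis.repr x i)

theorem measurable_gaussianLikelihood (hA : A.PosSemidef) : Measurable (gaussianLikelihood hA) :=
  Finset.measurable_prod _ fun i _ => (measurable_gaussianRatio _).comp (by fun_prop)

theorem repr_sum_smul {ι : Type*} [Fintype ι] (b : OrthonormalBasis ι ℝ (EuclideanSpace ℝ ι))
    (x : ι → ℝ) (i : ι) :
    b.repr (∑ j, x j • b j) i = x i := by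
  rw [b.repr_apply_apply, b.orthonormal.inner_right_fintype]

theorem gaussianLikelihood_sum_smul (hA : A.PosSemidef) (x : ι → ℝ) :
    gaussianLikelihood hA (∑ i, x i • hA.1.eigenvectorBasis i) =
      ∏ i, gaussianRatio (hA.1.eigenvalues i).toNNReal (x i) := by
  simp only [gaussianLikelihood, repr_sum_smul]

theorem multivariateGaussian_eq_withDensity (hA : A.PosSemidef)
    (hpos : ∀ i, 0 < hA.1.eigenvalues i) :
    multivariateGaussian 0 A =
      (stdGaussian (EuclideanSpace ℝ ι)).withDensity (gaussianLikelihood hA) := by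
  have hmeas : Measurable fun x : ι → ℝ => ∑ i, x i • hA.1.eigenvectorBasis i := by fun_prop
  have hne : ∀ i, (hA.1.eigenvalues i).toNNReal ≠ 0 := fun i => by simpa using hpos i
  rw [multivariateGaussian_eq_map_pi hA,
    stdGaussian_eq_map_pi_orthonormalBasis hA.1.eigenvectorBasis,
    ← map_withDensity_comp hmeas (measurable_gaussianLikelihood hA)]
  congr 1
  simp_rw [← fun i => withDensity_gaussianRatio (hne i)]
  have : ∀ i, SigmaFinite
      ((gaussianReal 0 1).withDensity (gaussianRatio (hA.1.eigenvalues i).toNNReal)) := fun i => by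
    rw [withDensity_gaussianRatio (hne i)]; infer_instance
  rw [pi_withDensity _ fun i => measurable_gaussianRatio _]
  congr 1
  ext x
  exact (gaussianLikelihood_sum_smul hA x).symm

theorem lintegral_gaussianLikelihood_sq (hA : A.PosSemidef)
    (hpos : ∀ i, 0 < hA.1.eigenvalues i) (hlt : ∀ i, hA.1.eigenvalues i < 2) :
    ∫⁻ x, gaussianLikelihood hA x ^ 2 ∂stdGaussian (EuclideanSpace ℝ ι) =
      ∏ i, ENNReal.ofReal (√(hA.1.eigenvalues i * (2 - hA.1.eigenvalues i)))⁻¹ := by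
  have hmeas : Measurable fun x : ι → ℝ => ∑ i, x i • hA.1.eigenvectorBasis i := by fun_prop
  rw [stdGaussian_eq_map_pi_orthonormalBasis hA.1.eigenvectorBasis,
    lintegral_map ((measurable_gaussianLikelihood hA).pow_const 2) hmeas]
  simp_rw [gaussianLikelihood_sum_smul, ← Finset.prod_pow]
  rw [lintegral_pi_prod _ fun i => (measurable_gaussianRatio _).pow_const 2]
  refine Finset.prod_congr rfl fun i _ => ?_
  rw [lintegral_gaussianRatio_sq (by simpa using hpos i)
    (by rw [← NNReal.coe_lt_coe, Real.coe_toNNReal _ (hpos i).le]; exact hlt i),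
    Real.coe_toNNReal _ (hpos i).le]

/-- The squared Frobenius distance of a symmetric matrix from the identity is the sum of the
squared distances of its eigenvalues from `1`. -/
theorem sum_eigenvalues_sub_one_sq (hA : A.IsHermitian) :
    ∑ i, (hA.eigenvalues i - 1) ^ 2 = ∑ j, ∑ i, (A i j - (1 : Matrix ι ι ℝ) i j) ^ 2 := by
  set b := hA.eigenvectorBasis
  set T := (A - 1).toEuclideanLin with hT
  have hsymm : T.IsSymmetric :=
    Matrix.isSymmetric_toEuclideanLin_iff.2 (hA.sub Matrix.isHermitian_one)
  have hb : ∀ i, T (b i) = (hA.eigenvalues i - 1) • b i := fun i => by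
    rw [hT, Matrix.toLpLin_apply, Matrix.sub_mulVec, hA.mulVec_eigenvectorBasis, Matrix.one_mulVec,
      sub_smul, one_smul]
    rfl
  have h1 : ∀ i, (hA.eigenvalues i - 1) ^ 2 = ‖T (b i)‖ ^ 2 := fun i => by
    rw [hb, norm_smul, b.orthonormal.1 i, mul_one, Real.norm_eq_abs, sq_abs]
  have h2 : ∀ j, ∑ i, (A i j - (1 : Matrix ι ι ℝ) i j) ^ 2 =
      ‖T (EuclideanSpace.single j 1)‖ ^ 2 := fun j => by
    rw [EuclideanSpace.real_norm_sq_eq]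
    refine Finset.sum_congr rfl fun i _ => ?_
    simp [hT, Matrix.toLpLin_apply, Matrix.one_apply]
  simp_rw [h1, h2]
  -- Expand `‖T b_i‖²` in the standard basis and `‖T e_j‖²` in the eigenbasis.
  have h3 : ∀ i, ‖T (b i)‖ ^ 2 = ∑ j, ⟪EuclideanSpace.basisFun ι ℝ j, T (b i)⟫ ^ 2 := fun i =>
    ((EuclideanSpace.basisFun ι ℝ).sum_sq_inner_right _).symm
  have h4 : ∀ j, ‖T (EuclideanSpace.single j 1)‖ ^ 2 =
      ∑ i, ⟪b i, T (EuclideanSpace.basisFun ι ℝ j)⟫ ^ 2 := fun j => by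
    rw [b.sum_sq_inner_right, EuclideanSpace.basisFun_apply]
  simp_rw [h3, h4]
  rw [Finset.sum_comm]
  refine Finset.sum_congr rfl fun j _ => Finset.sum_congr rfl fun i _ => ?_
  rw [← hsymm, real_inner_comm]

theorem eigenvalue_eq_inner (hA : A.IsHermitian) (i : ι) :
    hA.eigenvalues i =
      (hA.eigenvectorBasis i).ofLp ⬝ᵥ A.mulVec (hA.eigenvectorBasis i).ofLp := by
  simpa using hA.eigenvalues_eq i

/-- A bound for one factor of the second moment: with `t = l (2 - l) = 1 - (l - 1)²`,
`1 / √t = exp (-log t / 2)` and `-log t ≤ 1 / t - 1 = (l - 1)² / t ≤ 3 (l - 1)² / r`. -/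
theorem inv_sqrt_mul_two_sub_le {l r : ℝ} (hr : 0 < r) (hl : 1 / 3 ≤ l) (hl2 : r ≤ 2 - l) :
    (√(l * (2 - l)))⁻¹ ≤ Real.exp (3 / 2 * (l - 1) ^ 2 / r) := by
  have hl0 : 0 < l := by linarith
  have ht : r / 3 ≤ l * (2 - l) := by nlinarith
  have ht0 : 0 < l * (2 - l) := mul_pos hl0 (by linarith)
  set t := l * (2 - l) with htd
  have h1 : (l - 1) ^ 2 = 1 - t := by rw [htd]; ring
  have h2 : t⁻¹ ≤ Real.exp (3 * (l - 1) ^ 2 / r) := by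
    have h3 : t⁻¹ - 1 ≤ 3 * (l - 1) ^ 2 / r := by
      have : t⁻¹ - 1 = (l - 1) ^ 2 / t := by rw [h1]; field_simp
      rw [this, div_le_div_iff₀ ht0 hr]
      nlinarith [sq_nonneg (l - 1)]
    linarith [Real.add_one_le_exp (3 * (l - 1) ^ 2 / r)]
  rw [← Real.sqrt_inv]
  refine Real.sqrt_le_iff.2 ⟨(Real.exp_pos _).le, h2.trans ?_⟩
  rw [← Real.exp_nat_mul]
  apply le_of_eq
  congr 1
  push_cast
  ring

end Multivariate

/-! ### Testing against a mixture of independent likelihood ratios -/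

section Testing

variable {Ω : Type*} [MeasurableSpace Ω] {μ : Measure Ω}

/-- The Cauchy–Schwarz inequality for the covariance, from the sign of the quadratic polynomial
`t ↦ Var (X - t Y)`. -/
theorem covariance_sq_le [IsProbabilityMeasure μ] {X Y : Ω → ℝ} (hX : MemLp X 2 μ)
    (hY : MemLp Y 2 μ) :
    cov[X, Y; μ] ^ 2 ≤ Var[X; μ] * Var[Y; μ] := by
  have h : ∀ t : ℝ, 0 ≤ Var[Y; μ] * (t * t) + (-2 * cov[X, Y; μ]) * t + Var[X; μ] := fun t => by
    have h1 : 0 ≤ Var[X - t • Y; μ] := variance_nonneg _ _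
    rw [variance_sub hX (hY.const_smul t), variance_smul, covariance_smul_right] at h1
    nlinarith
  have := discrim_le_zero h
  rw [discrim] at this
  nlinarith

theorem withDensity_real_eq_setIntegral {L : Ω → ℝ≥0∞} (hL : Measurable L)
    (hL1 : ∫⁻ x, L x ∂μ = 1) {A : Set Ω} (hA : MeasurableSet A) :
    (μ.withDensity L).real A = ∫ x in A, (L x).toReal ∂μ := by
  rw [measureReal_def, withDensity_apply _ hA, integral_toReal hL.aemeasurable]
  exact ae_restrict_of_ae (ae_lt_top hL (by simp [hL1]))

theorem memLp_toReal_of_lintegral_sq {L : Ω → ℝ≥0∞} (hL : Measurable L)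
    (h2 : ∫⁻ x, L x ^ 2 ∂μ ≠ ∞) : MemLp (fun x => (L x).toReal) 2 μ := by
  rw [memLp_two_iff_integrable_sq hL.ennreal_toReal.aestronglyMeasurable]
  simp_rw [← ENNReal.toReal_pow]
  exact integrable_toReal_of_lintegral_ne_top (hL.pow_const 2).aemeasurable h2

/-- The second-moment bound for testing a simple null hypothesis against a uniform mixture. If
`X` is the sum of the likelihood ratios and `A` the rejection region, the risk equals
`1 - cov(1_A, X) / N`; the Cauchy–Schwarz inequality, `Var 1_A ≤ 1 / 4` and the additivity of the
variance over independent summands bound the covariance. -/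
theorem one_sub_le_risk_of_pairwise_indepFun [IsProbabilityMeasure μ] {κ : Type*}
    {C : Finset κ} (hC : C.Nonempty)
    {L : κ → Ω → ℝ≥0∞} {b : κ → ℝ} (hL : ∀ k ∈ C, Measurable (L k))
    (hL1 : ∀ k ∈ C, ∫⁻ x, L k x ∂μ = 1)
    (hL2 : ∀ k ∈ C, ∫⁻ x, L k x ^ 2 ∂μ ≤ ENNReal.ofReal (b k)) (hb : ∀ k ∈ C, 0 ≤ b k)
    (hind : ∀ k ∈ C, ∀ l ∈ C, k ≠ l → L k ⟂ᵢ[μ] L l) {A : Set Ω} (hA : MeasurableSet A) :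
    1 - 1 / (2 * (C.card : ℝ)) * √(∑ k ∈ C, b k) ≤
      μ.real A + ∑ k ∈ C, (C.card : ℝ)⁻¹ * (μ.withDensity (L k)).real Aᶜ := by
  have hN : (0 : ℝ) < C.card := by exact_mod_cast hC.card_pos
  set X : κ → Ω → ℝ := fun k x => (L k x).toReal with hX
  have hXp : ∀ k ∈ C, MemLp (X k) 2 μ := fun k hk =>
    memLp_toReal_of_lintegral_sq (hL k hk) ((hL2 k hk).trans_lt ENNReal.ofReal_lt_top).ne
  have hXi : ∀ k ∈ C, Integrable (X k) μ := fun k hk => (hXp k hk).integrable one_le_two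
  have hX1 : ∀ k ∈ C, ∫ x, X k x ∂μ = 1 := fun k hk => by
    rw [hX, integral_toReal (hL k hk).aemeasurable (ae_lt_top (hL k hk) (by simp [hL1 k hk])),
      hL1 k hk, ENNReal.toReal_one]
  have hvar : Var[∑ k ∈ C, X k; μ] ≤ ∑ k ∈ C, b k := by
    rw [IndepFun.variance_sum hXp fun k hk l hl hkl =>
      (hind k hk l hl hkl).comp ENNReal.measurable_toReal ENNReal.measurable_toReal]
    refine Finset.sum_le_sum fun k hk => (variance_le_expectation_sq (hXp k hk).1).trans ?_
    have h2 : ∫ x, (X k ^ 2) x ∂μ = (∫⁻ x, L k x ^ 2 ∂μ).toReal := by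
      rw [← integral_toReal ((hL k hk).pow_const 2).aemeasurable
        (ae_lt_top ((hL k hk).pow_const 2) ((hL2 k hk).trans_lt ENNReal.ofReal_lt_top).ne)]
      simp [hX, ENNReal.toReal_pow]
    rw [h2]
    exact ENNReal.toReal_le_of_le_ofReal (hb k hk) (hL2 k hk)
  set I : Ω → ℝ := A.indicator fun _ => 1 with hI
  have hIp : MemLp I 2 μ := memLp_indicator_const 2 hA 1 (Or.inr (measure_ne_top _ _))
  have hIvar : Var[I; μ] ≤ 1 / 4 := by
    refine (variance_le_sq_of_bounded (a := 0) (b := 1) (ae_of_all _ fun x => ?_)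
      hIp.1.aemeasurable).trans (by norm_num)
    by_cases hx : x ∈ A <;> simp [hI, hx]
  have hcov : cov[I, ∑ k ∈ C, X k; μ] = ∑ k ∈ C, ((μ.withDensity (L k)).real A - μ.real A) := by
    rw [covariance_sum_right' (fun k hk => hXp k hk) hIp]
    refine Finset.sum_congr rfl fun k hk => ?_
    rw [covariance_eq_sub hIp (hXp k hk), hX1 k hk, mul_one,
      withDensity_real_eq_setIntegral (hL k hk) (hL1 k hk) hA]
    congr 1
    · rw [← integral_indicator hA]
      refine integral_congr_ae (ae_of_all _ fun x => ?_)
      by_cases hx : x ∈ A <;> simp [hI, hx, hX]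
    · simp [hI, integral_indicator hA]
  have hle : cov[I, ∑ k ∈ C, X k; μ] ≤ √(∑ k ∈ C, b k) / 2 := by
    have hS : MemLp (∑ k ∈ C, X k) 2 μ := memLp_finsetSum' C hXp
    have h1 := covariance_sq_le hIp hS
    have h2 : Var[I; μ] * Var[∑ k ∈ C, X k; μ] ≤ 1 / 4 * ∑ k ∈ C, b k :=
      mul_le_mul hIvar hvar (variance_nonneg _ _) (by norm_num)
    refine abs_le_of_sq_le_sq' (?_ : _ ≤ (√(∑ k ∈ C, b k) / 2) ^ 2) (by positivity) |>.2
    rw [div_pow, Real.sq_sqrt (Finset.sum_nonneg hb)]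
    linarith
  have hcompl : ∀ k ∈ C, (μ.withDensity (L k)).real Aᶜ = 1 - (μ.withDensity (L k)).real A :=
    fun k hk => by
      have : IsProbabilityMeasure (μ.withDensity (L k)) := ⟨by simp [hL1 k hk]⟩
      exact probReal_compl_eq_one_sub hA
  rw [← Finset.mul_sum, Finset.sum_congr rfl hcompl]
  rw [hcov] at hle
  simp only [Finset.sum_sub_distrib, Finset.sum_const, nsmul_eq_mul, mul_one] at hle ⊢
  have h3 : μ.real A + (C.card : ℝ)⁻¹ * (C.card - ∑ k ∈ C, (μ.withDensity (L k)).real A) =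
      1 - (C.card : ℝ)⁻¹ * (∑ k ∈ C, (μ.withDensity (L k)).real A - C.card * μ.real A) := by
    field_simp
    ring
  rw [h3]
  have h4 : 1 / (2 * (C.card : ℝ)) * √(∑ k ∈ C, b k) =
      (C.card : ℝ)⁻¹ * (√(∑ k ∈ C, b k) / 2) := by field_simp
  rw [h4]
  gcongr

end Testing

/-! ### The alternative law as a density over the null law -/

variable {m : ℕ} {φ : nbhd d h → ℝ} {Γ : EllTwo d →L[ℝ] EllTwo d}

/-- The element of `ℓ²(ℤ^d)` supported on `S` with values `y`. -/
def extend (S : Finset (Box d m)) (y : S → ℝ) : EllTwo d :=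
  ∑ i : S, y i • lp.single 2 ((i : Box d m) : Fin d → ℤ) (1 : ℝ)

theorem norm_extend_sq (S : Finset (Box d m)) (y : S → ℝ) : ‖extend S y‖ ^ 2 = ∑ i, y i ^ 2 := by
  rw [← real_inner_self_eq_norm_sq]
  simp only [extend, sum_inner, inner_sum, real_inner_smul_left, real_inner_smul_right,
    inner_single, lp.coeFn_single, Pi.single_apply, SetLike.coe_eq_coe]
  simp [sq]

theorem inner_extend (Γ : EllTwo d →L[ℝ] EllTwo d) (S : Finset (Box d m)) (y : S → ℝ) :
    ⟪Γ (extend S y), extend S y⟫ = y ⬝ᵥ (subCov Γ S).mulVec y := by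
  simp only [extend, map_sum, map_smul, sum_inner, inner_sum, real_inner_smul_left,
    real_inner_smul_right, ← entry_eq_inner, dotProduct, Matrix.mulVec, subCov, Matrix.of_apply,
    Finset.mul_sum]
  refine Finset.sum_congr rfl fun i _ => Finset.sum_congr rfl fun j _ => ?_
  ring

theorem IsGMRFCovariance.entry_comm (hΓ : IsGMRFCovariance φ Γ) (i j : Fin d → ℤ) :
    entry Γ i j = entry Γ j i := by
  rw [entry_eq_inner, entry_eq_inner, real_inner_comm]
  exact (hΓ.isPositive.isSymmetric _ _).symm

theorem posSemidef_subCov (hΓ : IsGMRFCovariance φ Γ) (S : Finset (Box d m)) :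
    (subCov Γ S).PosSemidef := by
  refine Matrix.PosSemidef.of_dotProduct_mulVec_nonneg ?_ fun y => ?_
  · ext i j
    simp [subCov, hΓ.entry_comm j i]
  · rw [star_trivial, ← inner_extend]
    exact hΓ.isPositive.inner_nonneg_left _

theorem sum_sq_eigenvectorBasis {ι : Type*} [Fintype ι] [DecidableEq ι] {A : Matrix ι ι ℝ}
    (hA : A.IsHermitian) (i : ι) : ∑ j, (hA.eigenvectorBasis i).ofLp j ^ 2 = 1 := by
  rw [← EuclideanSpace.real_norm_sq_eq, hA.eigenvectorBasis.orthonormal.1 i, one_pow]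

theorem third_le_eigenvalues_subCov (hΓ : IsGMRFCovariance φ Γ) (hφ : normOne φ < 1 / 2)
    (S : Finset (Box d m)) (i : S) : 1 / 3 ≤ (posSemidef_subCov hΓ S).1.eigenvalues i := by
  rw [eigenvalue_eq_inner, ← inner_extend]
  refine le_trans ?_ (hΓ.third_le_inner hφ _)
  rw [norm_extend_sq, sum_sq_eigenvectorBasis]

theorem le_two_sub_eigenvalues_subCov (hΓ : IsGMRFCovariance φ Γ) (hφ : normOne φ < 1 / 2)
    (S : Finset (Box d m)) (i : S) :
    1 - 2 * normOne φ ≤ 2 - (posSemidef_subCov hΓ S).1.eigenvalues i := by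
  have h := hΓ.inner_le hφ (extend S ((posSemidef_subCov hΓ S).1.eigenvectorBasis i).ofLp)
  rw [norm_extend_sq, sum_sq_eigenvectorBasis, inner_extend, ← eigenvalue_eq_inner] at h
  have ha : 0 ≤ normOne φ := Finset.sum_nonneg fun _ _ => abs_nonneg _
  -- `1 / (1 - a) ≤ 1 + 2 a` for `0 ≤ a ≤ 1 / 2`.
  by_contra! hlt
  nlinarith

theorem sum_eigenvalues_subCov_sub_one_sq_le (hΓ : IsGMRFCovariance φ Γ)
    (hφ : normOne φ < 1 / 2) (S : Finset (Box d m)) :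
    ∑ i, ((posSemidef_subCov hΓ S).1.eigenvalues i - 1) ^ 2 ≤ S.card * (4 * normTwoSq φ) := by
  rw [sum_eigenvalues_sub_one_sq]
  have hcol : ∀ j : S, ∑ i, (subCov Γ S i j - (1 : Matrix S S ℝ) i j) ^ 2 ≤
      4 * normTwoSq φ := fun j => by
    refine le_trans (le_of_eq ?_) (hΓ.sum_entry_sq_le hφ ((j : Box d m) : Fin d → ℤ)
      (((Finset.univ.erase j).map (Function.Embedding.subtype _)).map
        (Function.Embedding.subtype _)) (by simp))
    rw [Finset.sum_map, Finset.sum_map, ← Finset.add_sum_erase _ _ (Finset.mem_univ j)]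
    have h0 : (subCov Γ S j j - (1 : Matrix S S ℝ) j j) ^ 2 = 0 := by
      simp [subCov, hΓ.unit_variance]
    rw [h0, zero_add]
    refine Finset.sum_congr rfl fun i hi => ?_
    rw [Matrix.one_apply_ne (Finset.ne_of_mem_erase hi), sub_zero]
    rfl
  refine (Finset.sum_le_sum fun j _ => hcol j).trans (le_of_eq ?_)
  simp

/-- The likelihood ratio of `ℙ_{S,Γ}` against `ℙ₀`. -/
def likelihood (hΓ : IsGMRFCovariance φ Γ) (S : Finset (Box d m)) (x : Box d m → ℝ) : ℝ≥0∞ :=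
  gaussianLikelihood (posSemidef_subCov hΓ S) (WithLp.toLp 2 fun i : S => x i)

theorem measurable_likelihood (hΓ : IsGMRFCovariance φ Γ) (S : Finset (Box d m)) :
    Measurable (likelihood hΓ S) :=
  (measurable_gaussianLikelihood _).comp (by fun_prop)

instance isProbabilityMeasure_nullLaw : IsProbabilityMeasure (nullLaw d m) := by
  unfold nullLaw; infer_instance

/-- Measurability of the map that takes the coordinates in `S` from the first vector and the others
from the second; `altLaw` is an image measure under it. -/
theorem measurable_glue (S : Finset (Box d m)) :
    Measurable fun (p : EuclideanSpace ℝ S × (Box d m → ℝ)) (i : Box d m) =>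
      if hi : i ∈ S then p.1 ⟨i, hi⟩ else p.2 i := by
  refine measurable_pi_lambda _ fun i => ?_
  by_cases hi : i ∈ S <;> simp only [hi, dite_true, dite_false] <;> fun_prop

/-- Replacing the coordinates in `S` by independent standard normal ones does not change the null
law. -/
theorem map_glue_stdGaussian_prod_nullLaw (S : Finset (Box d m)) :
    ((stdGaussian (EuclideanSpace ℝ S)).prod (nullLaw d m)).map
      (fun p i => if hi : i ∈ S then p.1 ⟨i, hi⟩ else p.2 i) = nullLaw d m := by
  symm
  refine Measure.pi_eq fun s hs => ?_
  rw [Measure.map_apply (measurable_glue S) (MeasurableSet.univ_pi hs)]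
  have hpre : (fun (p : EuclideanSpace ℝ S × (Box d m → ℝ)) (i : Box d m) =>
      if hi : i ∈ S then p.1 ⟨i, hi⟩ else p.2 i) ⁻¹' Set.univ.pi s =
      (WithLp.ofLp ⁻¹' Set.univ.pi fun i : S => s i) ×ˢ
        Set.univ.pi fun i => if i ∈ S then Set.univ else s i := by
    ext p
    simp only [Set.mem_preimage, Set.mem_pi, Set.mem_univ, true_implies, Set.mem_prod]
    constructor
    · intro hp
      refine ⟨fun i => ?_, fun i => ?_⟩
      · have := hp i
        rwa [dif_pos i.2] at this
      · split_ifs with hi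
        · trivial
        · have := hp i
          rwa [dif_neg hi] at this
    · rintro ⟨h1, h2⟩ i
      split_ifs with hi
      · exact h1 ⟨i, hi⟩
      · have := h2 i
        rwa [if_neg hi] at this
  rw [hpre, Measure.prod_prod, ← map_pi_eq_stdGaussian, Measure.map_apply (by fun_prop)
    ((MeasurableSet.univ_pi fun i : S => hs i).preimage (by fun_prop)), ← Set.preimage_comp]
  change Measure.pi (fun _ : S => gaussianReal 0 1) (Set.univ.pi fun i : S => s i) * _ = _
  rw [Measure.pi_pi, nullLaw, Measure.pi_pi,
    Finset.prod_coe_sort S fun i => (gaussianReal 0 1) (s i), ← Finset.prod_ite_mem_eq,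
    ← Finset.prod_mul_distrib]
  refine Finset.prod_congr rfl fun i _ => ?_
  by_cases hi : i ∈ S <;> simp [hi]

theorem altLaw_eq_withDensity (hΓ : IsGMRFCovariance φ Γ) (hφ : normOne φ < 1 / 2)
    (S : Finset (Box d m)) : altLaw Γ S = (nullLaw d m).withDensity (likelihood hΓ S) := by
  have hpos : ∀ i, 0 < (posSemidef_subCov hΓ S).1.eigenvalues i := fun i =>
    lt_of_lt_of_le (by norm_num) (third_le_eigenvalues_subCov hΓ hφ S i)
  have hsf : SFinite ((stdGaussian (EuclideanSpace ℝ S)).withDensity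
      (gaussianLikelihood (posSemidef_subCov hΓ S))) := by
    rw [← multivariateGaussian_eq_withDensity _ hpos]; infer_instance
  rw [altLaw, multivariateGaussian_eq_withDensity (posSemidef_subCov hΓ S) hpos,
    prod_withDensity_left (measurable_gaussianLikelihood _)]
  conv_rhs => rw [← map_glue_stdGaussian_prod_nullLaw S,
    ← map_withDensity_comp (measurable_glue S) (measurable_likelihood hΓ S)]
  congr 2
  ext p
  simp [likelihood]

theorem measurePreserving_restrict (S : Finset (Box d m)) :
    MeasurePreserving (fun (x : Box d m → ℝ) => (WithLp.toLp 2 fun i : S => x i :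
      EuclideanSpace ℝ S)) (nullLaw d m) (stdGaussian (EuclideanSpace ℝ S)) := by
  refine ⟨by fun_prop, ?_⟩
  conv_lhs => rw [← map_glue_stdGaussian_prod_nullLaw S]
  rw [Measure.map_map (by fun_prop) (measurable_glue S)]
  have hcomp : (fun (x : Box d m → ℝ) => (WithLp.toLp 2 fun i : S => x i : EuclideanSpace ℝ S)) ∘
      (fun (p : EuclideanSpace ℝ S × (Box d m → ℝ)) (i : Box d m) =>
        if hi : i ∈ S then p.1 ⟨i, hi⟩ else p.2 i) = Prod.fst := by
    ext p i
    simp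
  rw [hcomp, Measure.map_fst_prod, measure_univ, one_smul]

theorem lintegral_likelihood (hΓ : IsGMRFCovariance φ Γ) (hφ : normOne φ < 1 / 2)
    (S : Finset (Box d m)) : ∫⁻ x, likelihood hΓ S x ∂nullLaw d m = 1 := by
  have hpos : ∀ i, 0 < (posSemidef_subCov hΓ S).1.eigenvalues i := fun i =>
    lt_of_lt_of_le (by norm_num) (third_le_eigenvalues_subCov hΓ hφ S i)
  have h := (measurePreserving_restrict S).lintegral_comp
    (measurable_gaussianLikelihood (posSemidef_subCov hΓ S))
  refine h.trans ?_
  rw [← setLIntegral_univ, ← withDensity_apply _ MeasurableSet.univ,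
    ← multivariateGaussian_eq_withDensity _ hpos, measure_univ]

/-- The second moment of the likelihood ratio. The proof gives the constant `6` in place of `10`. -/
theorem lintegral_likelihood_sq_le (hΓ : IsGMRFCovariance φ Γ) (hφ : normOne φ < 1 / 2)
    (S : Finset (Box d m)) :
    ∫⁻ x, likelihood hΓ S x ^ 2 ∂nullLaw d m ≤ ENNReal.ofReal
      (Real.exp (10 * (S.card : ℝ) * normTwoSq φ / (1 - 2 * normOne φ))) := by
  have hthird := third_le_eigenvalues_subCov hΓ hφ S
  have htwo := le_two_sub_eigenvalues_subCov hΓ hφ S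
  have hr : 0 < 1 - 2 * normOne φ := by linarith
  have h := (measurePreserving_restrict S).lintegral_comp
    ((measurable_gaussianLikelihood (posSemidef_subCov hΓ S)).pow_const 2)
  refine h.trans_le ?_
  rw [lintegral_gaussianLikelihood_sq _ (fun i => lt_of_lt_of_le (by norm_num) (hthird i))
    fun i => by linarith [htwo i]]
  refine (Finset.prod_le_prod' fun i _ => ENNReal.ofReal_le_ofReal
    (inv_sqrt_mul_two_sub_le hr (hthird i) (htwo i))).trans ?_
  rw [← ENNReal.ofReal_prod_of_nonneg fun i _ => (Real.exp_pos _).le, ← Real.exp_sum,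
    ← Finset.sum_div, ← Finset.mul_sum]
  refine ENNReal.ofReal_le_ofReal (Real.exp_le_exp.2 (div_le_div_of_nonneg_right ?_ hr.le))
  have h4 := sum_eigenvalues_subCov_sub_one_sq_le hΓ hφ S
  have h5 : 0 ≤ normTwoSq φ := Finset.sum_nonneg fun _ _ => sq_nonneg _
  have h6 : 0 ≤ (S.card : ℝ) * normTwoSq φ := by positivity
  linarith

theorem indepFun_likelihood (hΓ : IsGMRFCovariance φ Γ) {S T : Finset (Box d m)}
    (hST : Disjoint S T) : likelihood hΓ S ⟂ᵢ[nullLaw d m] likelihood hΓ T := by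
  have hind : iIndepFun (fun (i : Box d m) (x : Box d m → ℝ) => x i) (nullLaw d m) :=
    iIndepFun_pi (X := fun _ => id) fun _ => aemeasurable_id
  have h := hind.indepFun_finset S T hST fun i => measurable_pi_apply i
  exact h.comp
    (φ := fun y : S → ℝ => gaussianLikelihood (posSemidef_subCov hΓ S) (WithLp.toLp 2 y))
    (ψ := fun y : T → ℝ => gaussianLikelihood (posSemidef_subCov hΓ T) (WithLp.toLp 2 y))
    ((measurable_gaussianLikelihood _).comp (by fun_prop))
    ((measurable_gaussianLikelihood _).comp (by fun_prop))

/-! ### Bayes and minimax risks -/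

theorem bayesRisk_ge (hΓ : IsGMRFCovariance φ Γ) (hφ : normOne φ < 1 / 2)
    (C : Finset (Finset (Box d m))) (hC : C.Nonempty)
    (hdisj : ∀ S ∈ C, ∀ T ∈ C, S ≠ T → Disjoint S T) :
    1 - 1 / (2 * (C.card : ℝ)) * √(∑ S ∈ C, Real.exp
        (10 * (S.card : ℝ) * normTwoSq φ / (1 - 2 * normOne φ)))
      ≤ bayesRisk C (PMF.uniformOfFinset C hC) Γ := by
  have : Nonempty (Test d m) := ⟨⟨fun _ => 0, measurable_const⟩⟩
  refine le_ciInf fun f => ?_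
  have hA : MeasurableSet {x | f.1 x = 1} := f.2 (measurableSet_singleton 1)
  have hAc : {x | f.1 x = 0} = {x | f.1 x = 1}ᶜ := by
    ext x
    simp only [Set.mem_ofPred_eq, Set.mem_compl_iff]
    omega
  refine (one_sub_le_risk_of_pairwise_indepFun (μ := nullLaw d m) hC
    (fun S _ => measurable_likelihood hΓ S) (fun S _ => lintegral_likelihood hΓ hφ S)
    (fun S _ => lintegral_likelihood_sq_le hΓ hφ S) (fun S _ => (Real.exp_pos _).le)
    (fun S hS T hT hST => indepFun_likelihood hΓ (hdisj S hS T hT hST)) hA).trans (le_of_eq ?_)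
  rw [typeOne]
  congr 1
  refine Finset.sum_congr rfl fun S hS => ?_
  rw [typeTwo, altLaw_eq_withDensity hΓ hφ, hAc, PMF.uniformOfFinset_apply_of_mem hC hS]
  simp

theorem typeTwo_nonneg (S : Finset (Box d m)) (f : Test d m) : 0 ≤ typeTwo Γ S f :=
  measureReal_nonneg

theorem typeOne_add_iSup_nonneg (C : Finset (Finset (Box d m))) (f : Test d m) :
    0 ≤ typeOne f + ⨆ S : C, typeTwo Γ (S : Finset (Box d m)) f :=
  add_nonneg measureReal_nonneg (Real.iSup_nonneg fun _ => typeTwo_nonneg _ f)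

theorem bayesRisk_le_minimaxRisk {C : Finset (Finset (Box d m))} (hC : C.Nonempty) :
    bayesRisk C (PMF.uniformOfFinset C hC) Γ ≤ minimaxRisk C Γ := by
  have : Nonempty (Test d m) := ⟨⟨fun _ => 0, measurable_const⟩⟩
  refine ciInf_mono ⟨0, ?_⟩ fun f => ?_
  · rintro _ ⟨f, rfl⟩
    exact add_nonneg measureReal_nonneg (Finset.sum_nonneg fun S _ =>
      mul_nonneg ENNReal.toReal_nonneg (typeTwo_nonneg S f))
  · have hN : (C.card : ℝ) ≠ 0 := by exact_mod_cast hC.card_pos.ne'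
    gcongr
    calc ∑ S ∈ C, ((PMF.uniformOfFinset C hC) S).toReal * typeTwo Γ S f
        ≤ ∑ S ∈ C, (C.card : ℝ)⁻¹ * ⨆ S : C, typeTwo Γ (S : Finset (Box d m)) f := by
          refine Finset.sum_le_sum fun S hS => ?_
          rw [PMF.uniformOfFinset_apply_of_mem hC hS, ENNReal.toReal_inv, ENNReal.toReal_natCast]
          gcongr
          exact le_ciSup (f := fun S : C => typeTwo Γ (S : Finset (Box d m)) f)
            (Set.finite_range _).bddAbove ⟨S, hS⟩
      _ = ⨆ S : C, typeTwo Γ (S : Finset (Box d m)) f := by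
          rw [Finset.sum_const, nsmul_eq_mul, ← mul_assoc, mul_inv_cancel₀ hN, one_mul]

/-- The test that always rejects has risk one. -/
theorem minimaxRisk_le_one (C : Finset (Finset (Box d m))) : minimaxRisk C Γ ≤ 1 := by
  refine (ciInf_le ⟨0, ?_⟩ (⟨fun _ => 1, measurable_const⟩ : Test d m)).trans ?_
  · rintro _ ⟨f, rfl⟩
    exact typeOne_add_iSup_nonneg C f
  · simp [typeOne, typeTwo]

/-- The Bayes bound with every `|S|` replaced by the maximal one; the exponent is `-1 / 2` times the
quantity that tends to infinity in the asymptotic statement. -/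
theorem one_sub_exp_le_minimaxRisk (hΓ : IsGMRFCovariance φ Γ) (hφ : normOne φ < 1 / 2)
    {C : Finset (Finset (Box d m))} (hC : C.Nonempty)
    (hdisj : ∀ S ∈ C, ∀ T ∈ C, S ≠ T → Disjoint S T) :
    1 - Real.exp (-(Real.log (C.card : ℝ) -
      10 * normTwoSq φ / (1 - 2 * normOne φ) * ((C.sup Finset.card : ℕ) : ℝ)) / 2) / 2 ≤
      minimaxRisk C Γ := by
  refine le_trans ?_ ((bayesRisk_ge hΓ hφ C hC hdisj).trans (bayesRisk_le_minimaxRisk hC))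
  have hN : (0 : ℝ) < C.card := by exact_mod_cast hC.card_pos
  set K := 10 * normTwoSq φ / (1 - 2 * normOne φ) with hK
  set M : ℝ := ((C.sup Finset.card : ℕ) : ℝ) with hM
  have h5 : 0 ≤ normTwoSq φ := Finset.sum_nonneg fun _ _ => sq_nonneg _
  have hK0 : 0 ≤ K := div_nonneg (by positivity) (by linarith)
  have hsum : ∑ S ∈ C, Real.exp (10 * (S.card : ℝ) * normTwoSq φ / (1 - 2 * normOne φ)) ≤
      C.card * Real.exp (K * M) := by
    rw [← nsmul_eq_mul]
    refine Finset.sum_le_card_nsmul _ _ _ fun S hS => Real.exp_le_exp.2 ?_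
    have : (S.card : ℝ) ≤ M := Nat.cast_le.2 (Finset.le_sup (f := Finset.card) hS)
    calc 10 * (S.card : ℝ) * normTwoSq φ / (1 - 2 * normOne φ) = K * S.card := by rw [hK]; ring
      _ ≤ K * M := by gcongr
  have hsq : √(C.card * Real.exp (K * M)) =
      C.card * Real.exp (-(Real.log (C.card : ℝ) - K * M) / 2) := by
    rw [Real.sqrt_eq_iff_mul_self_eq (by positivity) (by positivity)]
    have : Real.exp (-(Real.log (C.card : ℝ) - K * M) / 2) *
        Real.exp (-(Real.log (C.card : ℝ) - K * M) / 2) = (C.card : ℝ)⁻¹ * Real.exp (K * M) := by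
      rw [← Real.exp_add, ← Real.exp_log hN, ← Real.exp_neg, ← Real.exp_add, Real.exp_log hN]
      congr 1
      ring
    rw [mul_mul_mul_comm, this]
    field_simp
  have hle := Real.sqrt_le_sqrt hsum
  rw [hsq] at hle
  have : 1 / (2 * (C.card : ℝ)) * √(∑ S ∈ C, Real.exp
      (10 * (S.card : ℝ) * normTwoSq φ / (1 - 2 * normOne φ))) ≤
      1 / (2 * (C.card : ℝ)) * (C.card * Real.exp (-(Real.log (C.card : ℝ) - K * M) / 2)) := by
    gcongr
  refine sub_le_sub_left (this.trans (le_of_eq ?_)) 1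
  field_simp

end GMRF

end

theorem mainTheorem7 :
    (∀ (d h m : ℕ) (φ : GMRF.nbhd d h → ℝ) (Γ : GMRF.EllTwo d →L[ℝ] GMRF.EllTwo d)
      (_ : GMRF.IsGMRFCovariance φ Γ) (_ : GMRF.normOne φ < 1 / 2)
      (C : Finset (Finset (GMRF.Box d m))) (hC : C.Nonempty)
      (_ : ∀ S ∈ C, ∀ T ∈ C, S ≠ T → Disjoint S T),
      1 - 1 / (2 * (C.card : ℝ)) *
          √(∑ S ∈ C, Real.exp
            (10 * (S.card : ℝ) * GMRF.normTwoSq φ / (1 - 2 * GMRF.normOne φ)))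
        ≤ GMRF.bayesRisk C (PMF.uniformOfFinset C hC) Γ) ∧
    (∀ (d h m : ℕ → ℕ) (φ : ∀ k, GMRF.nbhd (d k) (h k) → ℝ)
      (Γ : ∀ k, GMRF.EllTwo (d k) →L[ℝ] GMRF.EllTwo (d k))
      (_ : ∀ k, GMRF.IsGMRFCovariance (φ k) (Γ k)) (_ : ∀ k, GMRF.normOne (φ k) < 1 / 2)
      (C : ∀ k, Finset (Finset (GMRF.Box (d k) (m k)))) (_ : ∀ k, (C k).Nonempty)
      (_ : ∀ k, ∀ S ∈ C k, ∀ T ∈ C k, S ≠ T → Disjoint S T)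
      (_ : Tendsto (fun k => Real.log ((C k).card : ℝ) -
          10 * GMRF.normTwoSq (φ k) / (1 - 2 * GMRF.normOne (φ k)) *
            (((C k).sup Finset.card : ℕ) : ℝ)) atTop atTop),
      Tendsto (fun k => GMRF.minimaxRisk (C k) (Γ k)) atTop (𝓝 1)) := by
  refine ⟨fun d h m φ Γ hΓ hφ C hC hdisj => GMRF.bayesRisk_ge hΓ hφ C hC hdisj,
    fun d h m φ Γ hΓ hφ C hC hdisj hlim => ?_⟩
  refine tendsto_of_tendsto_of_tendsto_of_le_of_le ?_ tendsto_const_nhds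
    (fun k => GMRF.one_sub_exp_le_minimaxRisk (hΓ k) (hφ k) (hC k) (hdisj k))
    fun k => GMRF.minimaxRisk_le_one _
  have h1 := Real.tendsto_exp_atBot.comp
    ((tendsto_neg_atTop_atBot.comp hlim).atBot_div_const (two_pos : (0 : ℝ) < 2))
  simpa using (h1.div_const 2).const_sub 1
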